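/- Let $q>1$, $s\ge q$, $b>0$, $A>0$ and $C_1>0$. There is a constant $C>0$, depending only on $C_1,b,A,q,s$, such that the following holds for every measurable space $\mathcal X$, every probability distribution $P$ on $\mathcal X\times\mathbb R$, every $n\ge 1$ and every nonempty finite set $\mathcal G$ of measurable functions $g:\mathcal X\to\mathbb R$. Let $(X,Y)\sim P$ and let the training set $Z_1=(X_1,Y_1),\dots,Z_n=(X_n,Y_n)$ be i.i.d. with law $P$. For $g:\mathcal X\to\mathbb R$ measurable, let $R(g)=\mathbb E|Y-g(X)|^q$ be its risk, and for $0\le i\le n$ let $\Sigma_i(g)=\sum_{j=1}^{i}|Y_j-g(X_j)|^q$. Assume that $$\sup_{g\in\mathcal G,\,x\in\mathcal X}|g(x)|\le b\qquad\text{and}\qquad \mathbb E|Y|^s\le A .$$ Put $$\lambda=\begin{cases}C_1\left(\frac{\log|\mathcal G|}{n}\right)^{(q-1)/s}&\text{when } q\le s<2q-2,\\[1mm] C_1\left(\frac{\log|\mathcal G|}{n}\right)^{q/(s+2)}&\text{when } s\ge 2q-2,\end{cases}$$ and, for $0\le i\le n$, let $$\hat g_i(x)=\frac{\sum_{g\in\mathcal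 G}e^{-\lambda\Sigma_i(g)}\,g(x)}{\sum_{g\in\mathcal G}e^{-\lambda\Sigma_i(g)}}$$ be the mean of $g(x)$ when $g$ is drawn from the Gibbs distribution with density proportional to $e^{-\lambda\Sigma_i(g)}$ with respect to the uniform distribution on $\mathcal G$. Then the randomized algorithm that draws its prediction function uniformly among $\hat g_0,\dots,\hat g_n$ has expected risk $$\mathbb E\,\frac1{n+1}\sum_{i=0}^{n}R(\hat g_i)\;\le\;\begin{cases}\min_{g\in\mathcal G}R(g)+C\left(\frac{\log|\mathcal G|}{n}\right)^{1-(q-1)/s}&\text{when } q\le s\le 2q-2,\\[1mm] \min_{g\in\mathcal G}R(g)+C\left(\frac{\log|\mathcal G|}{n}\right)^{1-q/(s+2)}&\text{when } s\ge 2q-2,\end{cases}$$ where the expectation on the left is over the training set. -/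

import Mathlib

open MeasureTheory

namespace LqReg

/-- The `L_q`-loss `L(z, g) = |y - g(x)|^q` of the prediction function `g` on the
input-output pair `z = (x, y)`. -/
noncomputable def loss {X : Type*} (q : ℝ) (z : X × ℝ) (g : X → ℝ) : ℝ :=
  |z.2 - g z.1| ^ q

/-- The risk `R(g) = E_{Z ∼ P} L(Z, g)`. The loss is nonnegative, so the expectation is
taken in `[0, ∞]`. -/
noncomputable def risk {X : Type*} [MeasurableSpace X] (P : Measure (X × ℝ)) (q : ℝ)
    (g : X → ℝ) : ENNReal :=
  ∫⁻ z, ENNReal.ofReal (loss q z g) ∂P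

/-- The cumulative loss `Σ_i(g)` of `g` on the first `i` pairs of the training set
`Z = (Z_1, …, Z_n)` (which is indexed here by `0, …, n - 1`). -/
noncomputable def cumLoss {X : Type*} {n : ℕ} (q : ℝ) (Z : Fin n → X × ℝ) (i : ℕ)
    (g : X → ℝ) : ℝ :=
  ∑ j ∈ Finset.univ.filter (fun j : Fin n => (j : ℕ) < i), loss q (Z j) g

/-- Mass function of the uniform distribution on a finite set `G`. -/
noncomputable def uniformPrior {F : Type*} (G : Finset F) (_g : F) : ℝ :=
  1 / (G.card : ℝ)

/-- Mass function of the Gibbs distribution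
`π_{-h}(dg) = e^{-h(g)} / (E_{g' ∼ π} e^{-h(g')}) · π(dg)`, where the prior `π` on the
finite set `G` is given by its mass function. -/
noncomputable def gibbs {F : Type*} (G : Finset F) (π : F → ℝ) (h : F → ℝ) (g : F) : ℝ :=
  Real.exp (-h g) / (∑ g' ∈ G, π g' * Real.exp (-h g')) * π g

/-- The mixture `E_{g ∼ ρ} g : x ↦ E_{g ∼ ρ} g(x)` of the functions in the finite set `G`,
for a distribution on `G` with mass function `ρ`. -/
noncomputable def mixture {X : Type*} (G : Finset (X → ℝ)) (ρ : (X → ℝ) → ℝ) : X → ℝ :=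
  fun x => ∑ g ∈ G, ρ g * g x

/-- The mixture `E_{g ∼ π_{-lam Σ_i}} g`, where `π` is the uniform distribution on `G`. -/
noncomputable def progressiveMixture {X : Type*} {n : ℕ} (G : Finset (X → ℝ)) (q lam : ℝ)
    (Z : Fin n → X × ℝ) (i : ℕ) : X → ℝ :=
  mixture G (gibbs G (uniformPrior G) (fun g => lam * cumLoss q Z i g))

/-- The expected risk of the randomized algorithm that, from the training set `Z` of `n`
independent pairs with law `P`, draws its prediction function uniformly among
`E_{g ∼ π_{-lam Σ_0}} g, …, E_{g ∼ π_{-lam Σ_n}} g`: the expectation is over the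
training set and over the uniform draw of the index. -/
noncomputable def expectedRisk {X : Type*} [MeasurableSpace X] (P : Measure (X × ℝ))
    (n : ℕ) (G : Finset (X → ℝ)) (q lam : ℝ) : ENNReal :=
  ∫⁻ Z, (∑ i : Fin (n + 1), risk P q (progressiveMixture G q lam Z (i : ℕ))) / (n + 1 : ℕ)
    ∂(Measure.pi fun _ : Fin n => P)

/-- The choice of the parameter `lam`, as a function of `C₁`, `q`, `s` and
`r = log |G| / n`. -/
noncomputable def tunedLambda (C₁ q s r : ℝ) : ℝ :=
  if s < 2 * q - 2 then C₁ * r ^ ((q - 1) / s) else C₁ * r ^ (q / (s + 2))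

end LqReg

namespace LqReg

universe u

/-! The argument is online regret plus averaging. On any sequence of pairs, compare the loss of the
Gibbs mean at each round with the exponential mixture loss `mixLoss`, that is `-log E e^{-lam l} /
lam`. Under Gibbs weights this is a difference of log partition functions, so the sum over rounds
telescopes to at most the cumulative loss of any fixed `g` plus `log |G| / lam` (`sum_mixLoss_le`).

The per-round excess is `MixingBound`. Convexity of the loss alone bounds it by both `D` and `lam *
D ^ 2 / 2`, where `D = 2bq(|y|+b)^(q-1)` bounds the spread of the losses; for `s ≤ 2q - 2`
interpolation between the two gives the power `s` of `|y| + b`. For `s ≥ 2q - 2`, the excess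
vanishes while `lam * q * (|y|+b)^q ≤ q - 1`, by concavity of `exp (-lam x^q)`; beyond that
threshold the quadratic bound is inflated to the power `s`.

The mean with index `i` uses only the first `i` pairs, so its expected risk is its expected loss on
pair `i` of an i.i.d. sequence of `n + 1` pairs. Taking expectations bounds the excess risk by `K M
lam^κ + log |G| / (lam (n+1))`. With `lam = C₁ r^a`, `r = log |G| / n` and `κ = 1/a - 1`, both terms
are of order `r^(1-a)`. -/

/-! ### Elementary inequalities for exponentials and powers -/

lemma exp_neg_le_quadratic {x : ℝ} (hx : 0 ≤ x) : Real.exp (-x) ≤ 1 - x + x ^ 2 / 2 := by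
  have hd : ∀ t : ℝ, HasDerivAt (fun t => 1 - t + t ^ 2 / 2 - Real.exp (-t))
      (t - 1 + Real.exp (-t)) t := by
    intro t
    have h := ((((hasDerivAt_id t).const_sub 1).add ((hasDerivAt_pow 2 t).div_const 2)).sub
      (hasDerivAt_neg t).exp)
    refine h.congr_deriv ?_
    simp
    ring
  have hmono : Monotone (fun t : ℝ => 1 - t + t ^ 2 / 2 - Real.exp (-t)) := by
    refine monotone_of_deriv_nonneg (fun t => (hd t).differentiableAt) (fun t => ?_)
    rw [(hd t).deriv]
    linarith [Real.add_one_le_exp (-t)]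
  have := hmono hx
  simp at this
  linarith

/-- The second derivative is a nonpositive factor times `q - 1 - lam * q * x ^ q`, and the
hypothesis keeps this bracket nonnegative up to `u`. -/
lemma concaveOn_exp_neg_rpow {q lam u : ℝ} (hq : 1 < q) (hlam : 0 ≤ lam)
    (hu : lam * q * u ^ q ≤ q - 1) :
    ConcaveOn ℝ (Set.Icc 0 u) (fun x => Real.exp (-(lam * x ^ q))) := by
  have hd : ∀ x, 0 < x → HasDerivAt (fun x : ℝ => x ^ q) (q * x ^ (q - 1)) x := fun x hx =>
    Real.hasDerivAt_rpow_const (Or.inl hx.ne')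
  have he : ∀ x, 0 < x → HasDerivAt (fun x : ℝ => Real.exp (-(lam * x ^ q)))
      (Real.exp (-(lam * x ^ q)) * (-(lam * (q * x ^ (q - 1))))) x := fun x hx =>
    (((hd x hx).const_mul lam).neg).exp
  refine concaveOn_of_hasDerivWithinAt2_nonpos (convex_Icc 0 u)
    (f' := fun x => Real.exp (-(lam * x ^ q)) * (-(lam * (q * x ^ (q - 1)))))
    (f'' := fun x => Real.exp (-(lam * x ^ q)) * (-(lam * (q * x ^ (q - 1)))) *
        (-(lam * (q * x ^ (q - 1)))) +
      Real.exp (-(lam * x ^ q)) * (-(lam * (q * ((q - 1) * x ^ (q - 1 - 1)))))) ?_ ?_ ?_ ?_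
  · have : Continuous (fun x : ℝ => x ^ q) := Real.continuous_rpow_const (by linarith)
    fun_prop
  · intro x hx
    rw [interior_Icc] at hx
    exact (he x hx.1).hasDerivWithinAt
  · intro x hx
    rw [interior_Icc] at hx
    have h2 : HasDerivAt (fun x : ℝ => x ^ (q - 1)) ((q - 1) * x ^ (q - 1 - 1)) x :=
      Real.hasDerivAt_rpow_const (Or.inl hx.1.ne')
    exact ((he x hx.1).mul (((h2.const_mul q).const_mul lam).neg)).hasDerivWithinAt
  · intro x hx
    rw [interior_Icc] at hx
    obtain ⟨h0, h1⟩ := hx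
    have e1 : x ^ (q - 1) * x ^ (q - 1) = x ^ q * x ^ (q - 1 - 1) := by
      rw [← Real.rpow_add h0, ← Real.rpow_add h0]
      congr 1
      ring
    have e2 : lam * q * x ^ q ≤ q - 1 := by
      refine le_trans ?_ hu
      have : x ^ q ≤ u ^ q := Real.rpow_le_rpow h0.le h1.le (by linarith)
      have : 0 ≤ lam * q := by positivity
      gcongr
    have e3 : Real.exp (-(lam * x ^ q)) * (-(lam * (q * x ^ (q - 1)))) *
        (-(lam * (q * x ^ (q - 1)))) +
      Real.exp (-(lam * x ^ q)) * (-(lam * (q * ((q - 1) * x ^ (q - 1 - 1))))) =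
      -(Real.exp (-(lam * x ^ q)) * lam * q * x ^ (q - 1 - 1) * (q - 1 - lam * q * x ^ q)) := by
      linear_combination (Real.exp (-(lam * x ^ q)) * lam ^ 2 * q ^ 2) * e1
    rw [e3, neg_nonpos]
    have : 0 ≤ q - 1 - lam * q * x ^ q := by linarith
    positivity

lemma rpow_sub_rpow_le {q a c u : ℝ} (hq : 1 ≤ q) (ha : 0 ≤ a) (hc : 0 ≤ c) (hau : a ≤ u)
    (hcu : c ≤ u) : a ^ q - c ^ q ≤ q * u ^ (q - 1) * |a - c| := by
  have h := (convex_Icc 0 u).norm_image_sub_le_of_norm_hasDerivWithin_le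
    (f := fun x : ℝ => x ^ q) (f' := fun x => q * x ^ (q - 1)) (C := q * u ^ (q - 1))
    (fun x _ => (Real.hasDerivAt_rpow_const (Or.inr hq)).hasDerivWithinAt) ?_
    (x := c) (y := a) ⟨hc, hcu⟩ ⟨ha, hau⟩
  · exact (le_abs_self _).trans h
  · rintro x ⟨h0, h1⟩
    rw [Real.norm_of_nonneg (by positivity)]
    have : x ^ (q - 1) ≤ u ^ (q - 1) := Real.rpow_le_rpow h0 h1 (by linarith)
    gcongr

/-! ### Comparing the loss of a mean with the exponential mixture loss -/

section Jensen

variable {ι : Type*} (G : Finset ι) (ρ : ι → ℝ)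

lemma abs_sub_sum_le (h0 : ∀ g ∈ G, 0 ≤ ρ g) (h1 : ∑ g ∈ G, ρ g = 1) (y : ℝ) (v : ι → ℝ) :
    |y - ∑ g ∈ G, ρ g * v g| ≤ ∑ g ∈ G, ρ g * |y - v g| := by
  have : y - ∑ g ∈ G, ρ g * v g = ∑ g ∈ G, ρ g * (y - v g) := by
    simp_rw [mul_sub, Finset.sum_sub_distrib, ← Finset.sum_mul, h1, one_mul]
  rw [this]
  refine (Finset.abs_sum_le_sum_abs _ _).trans (Finset.sum_le_sum fun g hg => ?_)
  rw [abs_mul, abs_of_nonneg (h0 g hg)]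

lemma rpow_abs_sub_sum_le {q : ℝ} (hq : 1 ≤ q) (h0 : ∀ g ∈ G, 0 ≤ ρ g)
    (h1 : ∑ g ∈ G, ρ g = 1) (y : ℝ) (v : ι → ℝ) :
    |y - ∑ g ∈ G, ρ g * v g| ^ q ≤ ∑ g ∈ G, ρ g * |y - v g| ^ q := by
  refine (Real.rpow_le_rpow (abs_nonneg _) (abs_sub_sum_le G ρ h0 h1 y v) (by linarith)).trans ?_
  have := (convexOn_rpow hq).map_sum_le (t := G) (w := ρ) (p := fun g => |y - v g|) h0 h1
    (fun g _ => Set.mem_Ici.2 (abs_nonneg _))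
  simpa using this

/-- The loss suffered by the mixture `ρ`, in the sense of the exponential loss with
temperature `1 / lam`. -/
noncomputable def mixLoss (lam : ℝ) (l : ι → ℝ) : ℝ :=
  -Real.log (∑ g ∈ G, ρ g * Real.exp (-(lam * l g))) / lam

lemma sum_mul_exp_pos (h0 : ∀ g ∈ G, 0 ≤ ρ g) (h1 : ∑ g ∈ G, ρ g = 1) (f : ι → ℝ) :
    0 < ∑ g ∈ G, ρ g * Real.exp (f g) := by
  refine Finset.sum_pos' (fun g hg => mul_nonneg (h0 g hg) (Real.exp_pos _).le) ?_
  by_contra! h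
  have : ∑ g ∈ G, ρ g = 0 := Finset.sum_eq_zero fun g hg =>
    le_antisymm (by
      have := h g hg
      by_contra! h'
      exact absurd (mul_pos h' (Real.exp_pos (f g))) (not_lt.2 this)) (h0 g hg)
  linarith

lemma le_mixLoss_iff {lam : ℝ} (hlam : 0 < lam) (h0 : ∀ g ∈ G, 0 ≤ ρ g)
    (h1 : ∑ g ∈ G, ρ g = 1) (l : ι → ℝ) (c : ℝ) :
    c ≤ mixLoss G ρ lam l ↔
      ∑ g ∈ G, ρ g * Real.exp (-(lam * l g)) ≤ Real.exp (-(lam * c)) := by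
  rw [mixLoss, le_div_iff₀ hlam, ← Real.log_le_iff_le_exp (sum_mul_exp_pos G ρ h0 h1 _)]
  constructor <;> intro h <;> linarith

lemma le_mixLoss_of_le {lam α : ℝ} (hlam : 0 < lam) (h0 : ∀ g ∈ G, 0 ≤ ρ g)
    (h1 : ∑ g ∈ G, ρ g = 1) {l : ι → ℝ} (hα : ∀ g ∈ G, α ≤ l g) :
    α ≤ mixLoss G ρ lam l := by
  rw [le_mixLoss_iff G ρ hlam h0 h1]
  calc _ ≤ ∑ g ∈ G, ρ g * Real.exp (-(lam * α)) := by
        refine Finset.sum_le_sum fun g hg => mul_le_mul_of_nonneg_left ?_ (h0 g hg)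
        have := hα g hg
        gcongr
    _ = _ := by rw [← Finset.sum_mul, h1, one_mul]

lemma sum_mul_le_mixLoss_add {lam α D : ℝ} (hlam : 0 < lam) (h0 : ∀ g ∈ G, 0 ≤ ρ g)
    (h1 : ∑ g ∈ G, ρ g = 1) {l : ι → ℝ} (hα : ∀ g ∈ G, α ≤ l g) (hD : ∀ g ∈ G, l g ≤ α + D) :
    ∑ g ∈ G, ρ g * l g ≤ mixLoss G ρ lam l + D := by
  have : ∑ g ∈ G, ρ g * l g ≤ α + D := by
    calc _ ≤ ∑ g ∈ G, ρ g * (α + D) :=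
          Finset.sum_le_sum fun g hg => mul_le_mul_of_nonneg_left (hD g hg) (h0 g hg)
      _ = _ := by rw [← Finset.sum_mul, h1, one_mul]
  linarith [le_mixLoss_of_le G ρ hlam h0 h1 hα]

/-- Second-order expansion of `exp` around the base level `α`, averaged over `ρ`, followed by `1 + x
≤ e^x`. -/
lemma sum_mul_le_mixLoss_add_sq {lam α D : ℝ} (hlam : 0 < lam) (h0 : ∀ g ∈ G, 0 ≤ ρ g)
    (h1 : ∑ g ∈ G, ρ g = 1) {l : ι → ℝ} (hα : ∀ g ∈ G, α ≤ l g) (hD : ∀ g ∈ G, l g ≤ α + D) :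
    ∑ g ∈ G, ρ g * l g ≤ mixLoss G ρ lam l + lam * D ^ 2 / 2 := by
  rw [← sub_le_iff_le_add, le_mixLoss_iff G ρ hlam h0 h1]
  set E := ∑ g ∈ G, ρ g * l g with hE
  have key : ∀ g ∈ G, ρ g * Real.exp (-(lam * l g)) ≤ Real.exp (-(lam * α)) *
      (ρ g * (1 + lam * α + lam ^ 2 * D ^ 2 / 2) - lam * (ρ g * l g)) := by
    intro g hg
    have hx : 0 ≤ lam * (l g - α) := mul_nonneg hlam.le (by linarith [hα g hg])
    have h := exp_neg_le_quadratic hx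
    have h2 : (l g - α) ^ 2 ≤ D ^ 2 :=
      pow_le_pow_left₀ (by linarith [hα g hg]) (by linarith [hD g hg]) 2
    have h3 : Real.exp (-(lam * (l g - α))) ≤
        1 + lam * α + lam ^ 2 * D ^ 2 / 2 - lam * l g := by
      nlinarith [mul_le_mul_of_nonneg_left h2 (sq_nonneg lam)]
    have e : Real.exp (-(lam * l g)) =
        Real.exp (-(lam * α)) * Real.exp (-(lam * (l g - α))) := by
      rw [← Real.exp_add]
      congr 1
      ring
    rw [e]
    calc _ = (Real.exp (-(lam * α)) * ρ g) * Real.exp (-(lam * (l g - α))) := by ring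
      _ ≤ (Real.exp (-(lam * α)) * ρ g) *
          (1 + lam * α + lam ^ 2 * D ^ 2 / 2 - lam * l g) :=
        mul_le_mul_of_nonneg_left h3 (mul_nonneg (Real.exp_pos _).le (h0 g hg))
      _ = _ := by ring
  refine (Finset.sum_le_sum key).trans ?_
  rw [← Finset.mul_sum, Finset.sum_sub_distrib, ← Finset.sum_mul, ← Finset.mul_sum, h1, ← hE]
  calc _ ≤ Real.exp (-(lam * α)) * Real.exp (lam * α + lam ^ 2 * D ^ 2 / 2 - lam * E) := by
        refine mul_le_mul_of_nonneg_left ?_ (Real.exp_pos _).le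
        linarith [Real.add_one_le_exp (lam * α + lam ^ 2 * D ^ 2 / 2 - lam * E)]
    _ = _ := by
        rw [← Real.exp_add]
        congr 1
        ring

/-- Exact mixability for bounded residuals: Jensen for the concave `exp (-lam x^q)` leaves no excess
term. -/
lemma rpow_abs_sub_sum_le_mixLoss {q lam u : ℝ} (hq : 1 < q) (hlam : 0 < lam)
    (hu : lam * q * u ^ q ≤ q - 1) (h0 : ∀ g ∈ G, 0 ≤ ρ g) (h1 : ∑ g ∈ G, ρ g = 1)
    (y : ℝ) (v : ι → ℝ) (hv : ∀ g ∈ G, |y - v g| ≤ u) :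
    |y - ∑ g ∈ G, ρ g * v g| ^ q ≤ mixLoss G ρ lam (fun g => |y - v g| ^ q) := by
  rw [le_mixLoss_iff G ρ hlam h0 h1]
  have := (concaveOn_exp_neg_rpow hq hlam.le hu).le_map_sum (t := G) (w := ρ)
    (p := fun g => |y - v g|) h0 h1 (fun g hg => ⟨abs_nonneg _, hv g hg⟩)
  simp only [smul_eq_mul] at this
  refine this.trans ?_
  have h2 := Real.rpow_le_rpow (abs_nonneg _) (abs_sub_sum_le G ρ h0 h1 y v)
    (show 0 ≤ q by linarith)
  gcongr

end Jensen

/-- The right side is `x * (lam * x) ^ κ`; the two cases are `lam * x ≥ 1` and `lam * x ≤ 1`. -/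
lemma le_or_sq_le_rpow_mul_rpow {κ lam x : ℝ} (hκ0 : 0 ≤ κ) (hκ1 : κ ≤ 1) (hlam : 0 < lam)
    (hx : 0 < x) :
    x ≤ lam ^ κ * x ^ (1 + κ) ∨ lam * x ^ 2 / 2 ≤ lam ^ κ * x ^ (1 + κ) := by
  have e : lam ^ κ * x ^ (1 + κ) = x * (lam * x) ^ κ := by
    rw [Real.mul_rpow hlam.le hx.le, Real.rpow_add hx, Real.rpow_one]
    ring
  rw [e]
  have hpos : 0 < lam * x := mul_pos hlam hx
  rcases le_total 1 (lam * x) with h | h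
  · left
    have := Real.one_le_rpow h hκ0
    nlinarith
  · right
    have h1 : (lam * x) ^ (1 : ℝ) ≤ (lam * x) ^ κ := Real.rpow_le_rpow_of_exponent_ge hpos h hκ1
    rw [Real.rpow_one] at h1
    nlinarith

/-! ### The per-round excess in the two ranges of `s` -/

section Pointwise

variable {ι : Type*} (G : Finset ι) (ρ : ι → ℝ)

lemma rpow_abs_sub_sum_le_mixLoss_add {q b lam : ℝ} (hq : 1 < q) (hb : 0 < b) (hlam : 0 < lam)
    (h0 : ∀ g ∈ G, 0 ≤ ρ g) (h1 : ∑ g ∈ G, ρ g = 1) (y : ℝ) (v : ι → ℝ)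
    (hv : ∀ g ∈ G, |v g| ≤ b) :
    |y - ∑ g ∈ G, ρ g * v g| ^ q ≤ mixLoss G ρ lam (fun g => |y - v g| ^ q) +
        2 * b * q * (|y| + b) ^ (q - 1) ∧
    |y - ∑ g ∈ G, ρ g * v g| ^ q ≤ mixLoss G ρ lam (fun g => |y - v g| ^ q) +
        lam * (2 * b * q * (|y| + b) ^ (q - 1)) ^ 2 / 2 := by
  have hG : G.Nonempty := by
    by_contra h
    simp [Finset.not_nonempty_iff_eq_empty.1 h] at h1
  -- The smallest loss serves as the base level `α`.
  obtain ⟨g₀, hg₀, hmin⟩ := G.exists_min_image (fun g => |y - v g| ^ q) hG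
  have hu : ∀ g ∈ G, |y - v g| ≤ |y| + b := fun g hg =>
    (abs_sub y (v g)).trans (by linarith [hv g hg])
  have hD : ∀ g ∈ G, |y - v g| ^ q ≤ |y - v g₀| ^ q + 2 * b * q * (|y| + b) ^ (q - 1) := by
    intro g hg
    have h := rpow_sub_rpow_le hq.le (abs_nonneg _) (abs_nonneg _) (hu g hg) (hu g₀ hg₀)
    have h2 : |(|y - v g| - |y - v g₀|)| ≤ 2 * b := by
      refine (abs_abs_sub_abs_le_abs_sub _ _).trans ?_
      have e : y - v g - (y - v g₀) = v g₀ - v g := by ring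
      rw [e]
      exact (abs_sub _ _).trans (by linarith [hv g hg, hv g₀ hg₀])
    have h3 : 0 ≤ q * (|y| + b) ^ (q - 1) := by positivity
    nlinarith [mul_le_mul_of_nonneg_left h2 h3]
  have hJ := rpow_abs_sub_sum_le G ρ hq.le h0 h1 y v
  exact ⟨hJ.trans (sum_mul_le_mixLoss_add G ρ hlam h0 h1 hmin hD),
    hJ.trans (sum_mul_le_mixLoss_add_sq G ρ hlam h0 h1 hmin hD)⟩

/-- `MixingBound q s b κ K` says that predicting with the mean of a distribution on predictions
in `[-b, b]` costs at most the exponential mixture loss plus `K lam ^ κ (|y| + b) ^ s`. -/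
def MixingBound (q s b κ K : ℝ) : Prop :=
  ∀ {ι : Type u} (G : Finset ι) (ρ : ι → ℝ) (lam : ℝ), 0 < lam → (∀ g ∈ G, 0 ≤ ρ g) →
    ∑ g ∈ G, ρ g = 1 → ∀ (y : ℝ) (v : ι → ℝ), (∀ g ∈ G, |v g| ≤ b) →
    |y - ∑ g ∈ G, ρ g * v g| ^ q ≤ mixLoss G ρ lam (fun g => |y - v g| ^ q) +
      K * lam ^ κ * (|y| + b) ^ s

lemma mixingBound_of_le {q s b : ℝ} (hq : 1 < q) (hs : q ≤ s) (hs' : s ≤ 2 * q - 2)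
    (hb : 0 < b) :
    MixingBound.{u} q s b (1 / ((q - 1) / s) - 1) ((2 * b * q) ^ (s / (q - 1))) := by
  intro ι G ρ lam hlam h0 h1 y v hv
  obtain ⟨hA, hB⟩ := rpow_abs_sub_sum_le_mixLoss_add G ρ hq hb hlam h0 h1 y v hv
  have hq1 : 0 < q - 1 := by linarith
  have hu : 0 < |y| + b := by positivity
  set D := 2 * b * q * (|y| + b) ^ (q - 1) with hD
  have hDpos : 0 < D := by positivity
  have e : (2 * b * q) ^ (s / (q - 1)) * lam ^ (1 / ((q - 1) / s) - 1) * (|y| + b) ^ s =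
      lam ^ (s / (q - 1) - 1) * D ^ (1 + (s / (q - 1) - 1)) := by
    rw [one_div_div, add_sub_cancel, hD,
      Real.mul_rpow (x := 2 * b * q) (by positivity) (by positivity), ← Real.rpow_mul hu.le, mul_div_cancel₀ _ hq1.ne']
    ring
  rw [e]
  -- This `κ` makes `D ^ (1 + κ)` proportional to `(|y| + b) ^ s`; `κ ∈ [0, 1]` follows from `q ≤ s
  -- ≤ 2q - 2`.
  rcases le_or_sq_le_rpow_mul_rpow (κ := s / (q - 1) - 1)
    (by rw [sub_nonneg, le_div_iff₀ hq1]; linarith)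
    (by rw [sub_le_iff_le_add, div_le_iff₀ hq1]; linarith) hlam hDpos with h | h
  · linarith
  · linarith

lemma mixingBound_of_ge {q s b : ℝ} (hq : 1 < q) (hs' : 2 * q - 2 ≤ s)
    (hb : 0 < b) :
    MixingBound.{u} q s b (1 / (q / (s + 2)) - 1)
      ((2 * b * q) ^ 2 / 2 * (q / (q - 1)) ^ ((s + 2 - 2 * q) / q)) := by
  intro ι G ρ lam hlam h0 h1 y v hv
  have hq0 : 0 < q := by linarith
  have hq1 : 0 < q - 1 := by linarith
  have hu : 0 < |y| + b := by positivity
  by_cases hm : lam * q * (|y| + b) ^ q ≤ q - 1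
  · have := rpow_abs_sub_sum_le_mixLoss G ρ hq hlam hm h0 h1 y v fun g hg =>
      (abs_sub y (v g)).trans (by linarith [hv g hg])
    have h2 : 0 ≤ (2 * b * q) ^ 2 / 2 * (q / (q - 1)) ^ ((s + 2 - 2 * q) / q) *
      lam ^ (1 / (q / (s + 2)) - 1) * (|y| + b) ^ s := by positivity
    linarith
  · refine (rpow_abs_sub_sum_le_mixLoss_add G ρ hq hb hlam h0 h1 y v hv).2.trans ?_
    gcongr
    set u := |y| + b
    set τ := (s + 2 - 2 * q) / q with hτ
    have hτ0 : 0 ≤ τ := div_nonneg (by linarith) hq0.le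
    have eκ : 1 / (q / (s + 2)) - 1 = 1 + τ := by
      rw [hτ]
      field_simp
      ring
    have es : u ^ s = (u ^ (q - 1)) ^ 2 * (u ^ q) ^ τ := by
      rw [← Real.rpow_natCast, ← Real.rpow_mul hu.le, ← Real.rpow_mul hu.le, ← Real.rpow_add hu]
      congr 1
      rw [hτ]
      field_simp
      push_cast
      ring
    -- Past the concavity threshold this factor is at least 1. Multiplying by it raises `u ^ (2q -
    -- 2)` to `u ^ s` and `lam` to `lam ^ (1 + τ)`.
    have h1τ : 1 ≤ (q / (q - 1) * lam * u ^ q) ^ τ := by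
      refine Real.one_le_rpow ?_ hτ0
      have e : q / (q - 1) * lam * u ^ q = lam * q * u ^ q / (q - 1) := by ring
      rw [e, one_le_div hq1]
      exact (not_le.1 hm).le
    rw [Real.mul_rpow (by positivity) (by positivity),
      Real.mul_rpow (by positivity) hlam.le] at h1τ
    rw [eκ, es, Real.rpow_add hlam, Real.rpow_one]
    have hnn : 0 ≤ lam * (2 * b * q * u ^ (q - 1)) ^ 2 / 2 := by positivity
    calc _ ≤ lam * (2 * b * q * u ^ (q - 1)) ^ 2 / 2 *
          ((q / (q - 1)) ^ τ * lam ^ τ * (u ^ q) ^ τ) := le_mul_of_one_le_right hnn h1τ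
      _ = _ := by ring

end Pointwise

/-! ### Regret on a deterministic sequence -/

section Telescoping

variable {X : Type u}

lemma cumLoss_succ {n : ℕ} (q : ℝ) (W : Fin n → X × ℝ) (i : Fin n) (g : X → ℝ) :
    cumLoss q W (i + 1) g = cumLoss q W i g + loss q (W i) g := by
  have : Finset.univ.filter (fun j : Fin n => (j : ℕ) < i + 1) =
      insert i (Finset.univ.filter fun j : Fin n => (j : ℕ) < i) := by
    ext j
    simp only [Finset.mem_filter, Finset.mem_univ, true_and, Finset.mem_insert, Fin.ext_iff]
    omega
  rw [cumLoss, this, Finset.sum_insert (by simp), add_comm, cumLoss]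

lemma cumLoss_zero {n : ℕ} (q : ℝ) (W : Fin n → X × ℝ) (g : X → ℝ) : cumLoss q W 0 g = 0 := by
  simp [cumLoss]

lemma cumLoss_self {n : ℕ} (q : ℝ) (W : Fin n → X × ℝ) (g : X → ℝ) :
    cumLoss q W n g = ∑ j, loss q (W j) g := by
  simp [cumLoss]

/-- An insertion at position `i` leaves the entries before `i` in place, so a fresh pair can be put
there without altering the `i`-th mixture. -/
lemma cumLoss_insertNth {n : ℕ} (q : ℝ) (Z : Fin n → X × ℝ) (i : Fin (n + 1)) (z : X × ℝ)
    (g : X → ℝ) :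
    cumLoss q (i.insertNth z Z : Fin (n + 1) → X × ℝ) i g = cumLoss q Z i g := by
  have h : ∀ j : Fin n, i.succAbove j < i ↔ (j : ℕ) < i := fun j =>
    Fin.succAbove_lt_iff_castSucc_lt i j
  simp [cumLoss, Finset.sum_filter, Fin.sum_univ_succAbove _ i, h]

lemma progressiveMixture_insertNth {n : ℕ} (G : Finset (X → ℝ)) (q lam : ℝ)
    (Z : Fin n → X × ℝ) (i : Fin (n + 1)) (z : X × ℝ) :
    progressiveMixture G q lam (i.insertNth z Z : Fin (n + 1) → X × ℝ) i =
      progressiveMixture G q lam Z i := by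
  simp only [progressiveMixture, cumLoss_insertNth]

variable {F : Type*} {G : Finset F}

lemma partition_pos (hG : G.Nonempty) (h : F → ℝ) :
    0 < ∑ g ∈ G, uniformPrior G g * Real.exp (-h g) := by
  have := hG.card_pos
  exact Finset.sum_pos (fun g _ => by unfold uniformPrior; positivity) hG

lemma gibbs_nonneg (hG : G.Nonempty) (h : F → ℝ) (g : F) :
    0 ≤ gibbs G (uniformPrior G) h g := by
  have := partition_pos hG h
  unfold gibbs
  have : 0 ≤ uniformPrior G g := by unfold uniformPrior; positivity
  positivity

/-- With `h` the past loss and `l` the new one, both scaled by `lam`, this is a ratio of consecutive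
partition functions, the source of the telescoping. -/
lemma sum_gibbs_mul_exp (h l : F → ℝ) :
    ∑ g ∈ G, gibbs G (uniformPrior G) h g * Real.exp (-l g) =
      (∑ g ∈ G, uniformPrior G g * Real.exp (-(h g + l g))) /
        ∑ g ∈ G, uniformPrior G g * Real.exp (-h g) := by
  rw [Finset.sum_div]
  refine Finset.sum_congr rfl fun g _ => ?_
  rw [gibbs, neg_add, Real.exp_add]
  ring

lemma sum_gibbs (hG : G.Nonempty) (h : F → ℝ) : ∑ g ∈ G, gibbs G (uniformPrior G) h g = 1 := by
  have := sum_gibbs_mul_exp (G := G) h (fun _ => 0)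
  simp only [neg_zero, Real.exp_zero, mul_one, add_zero] at this
  rw [this, div_self (partition_pos hG h).ne']

lemma sum_mixLoss_le {n : ℕ} {G : Finset (X → ℝ)} {q lam : ℝ} (hlam : 0 < lam)
    (W : Fin n → X × ℝ) {g : X → ℝ} (hg : g ∈ G) :
    ∑ i : Fin n, mixLoss G (gibbs G (uniformPrior G) fun g => lam * cumLoss q W i g) lam
        (loss q (W i)) ≤
      ∑ i, loss q (W i) g + Real.log G.card / lam := by
  have hG : G.Nonempty := ⟨g, hg⟩
  have hcard : (0 : ℝ) < G.card := by exact_mod_cast hG.card_pos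
  set S : ℕ → ℝ := fun i => ∑ g ∈ G, uniformPrior G g * Real.exp (-(lam * cumLoss q W i g))
    with hS
  have hSpos : ∀ i, 0 < S i := fun i => partition_pos hG _
  have hstep : ∀ i : Fin n,
      mixLoss G (gibbs G (uniformPrior G) fun g => lam * cumLoss q W i g) lam (loss q (W i)) =
        (Real.log (S i) - Real.log (S (i + 1))) / lam := by
    intro i
    rw [mixLoss, sum_gibbs_mul_exp]
    simp_rw [← mul_add, ← cumLoss_succ]
    rw [Real.log_div (hSpos _).ne' (hSpos _).ne']
    ring
  have hS0 : S 0 = 1 := by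
    simp [hS, cumLoss_zero, uniformPrior, hcard.ne']
  -- Keeping only the term of `g` in the last partition function costs `log |G|`.
  have hSn : 1 / (G.card : ℝ) * Real.exp (-(lam * ∑ i, loss q (W i) g)) ≤ S n := by
    rw [← cumLoss_self]
    exact Finset.single_le_sum (f := fun g => uniformPrior G g *
      Real.exp (-(lam * cumLoss q W n g))) (fun g _ => by unfold uniformPrior; positivity) hg
  have hlog := Real.log_le_log (by positivity) hSn
  rw [Real.log_mul (by positivity) (by positivity), Real.log_exp, one_div, Real.log_inv] at hlog
  rw [Finset.sum_congr rfl fun i _ => hstep i,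
    Fin.sum_univ_eq_sum_range (fun i => (Real.log (S i) - Real.log (S (i + 1))) / lam) n,
    ← Finset.sum_div, Finset.sum_range_sub', hS0, Real.log_one, div_le_iff₀ hlam, add_mul,
    div_mul_cancel₀ _ hlam.ne']
  linarith

/-- The progressive mixtures have small regret on every sequence of observations. -/
lemma sum_loss_progressiveMixture_le {n : ℕ} {G : Finset (X → ℝ)} {q s b κ K lam : ℝ}
    (hK : MixingBound.{u} q s b κ K) (hlam : 0 < lam) (hbG : ∀ g ∈ G, ∀ x, |g x| ≤ b)
    (W : Fin n → X × ℝ) {g : X → ℝ} (hg : g ∈ G) :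
    ∑ i : Fin n, loss q (W i) (progressiveMixture G q lam W i) ≤
      ∑ i, (loss q (W i) g + K * lam ^ κ * (|(W i).2| + b) ^ s) + Real.log G.card / lam := by
  have hG : G.Nonempty := ⟨g, hg⟩
  have hi : ∀ i : Fin n, loss q (W i) (progressiveMixture G q lam W i) ≤
      mixLoss G (gibbs G (uniformPrior G) fun g => lam * cumLoss q W i g) lam (loss q (W i)) +
        K * lam ^ κ * (|(W i).2| + b) ^ s := fun i =>
    hK G (gibbs G (uniformPrior G) fun g => lam * cumLoss q W i g) lam hlam
      (fun g _ => gibbs_nonneg hG _ g) (sum_gibbs hG _) (W i).2 (fun g : X → ℝ => g (W i).1)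
      (fun g hg => hbG g hg _)
  have h := Finset.sum_le_sum fun (i : Fin n) (_ : i ∈ Finset.univ) => hi i
  have h2 := sum_mixLoss_le (q := q) hlam W hg
  rw [Finset.sum_add_distrib] at h ⊢
  linarith

end Telescoping

/-! ### From regret to expected risk -/

section Probability

variable {X : Type u} [MeasurableSpace X]

lemma measurable_abs_sub_rpow {F : Type*} [MeasurableSpace F] {q : ℝ} (hq : 0 ≤ q) {y g : F → ℝ}
    (hy : Measurable y) (hg : Measurable g) : Measurable fun w => |y w - g w| ^ q :=
  (Real.continuous_rpow_const hq).measurable.comp (continuous_abs.measurable.comp (hy.sub hg))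

lemma measurable_loss_progressiveMixture {n : ℕ} {G : Finset (X → ℝ)}
    (hG : ∀ g ∈ G, Measurable g) {q : ℝ} (hq : 0 ≤ q) (lam : ℝ) (i : Fin n) :
    Measurable fun W : Fin n → X × ℝ => loss q (W i) (progressiveMixture G q lam W i) := by
  have hc : ∀ g ∈ G, Measurable fun W : Fin n → X × ℝ => cumLoss q W i g := fun g hg =>
    Finset.measurable_sum _ fun j _ => measurable_abs_sub_rpow hq (measurable_pi_apply j).snd
      ((hG g hg).comp (measurable_pi_apply j).fst)
  have he : ∀ g ∈ G, Measurable fun W : Fin n → X × ℝ =>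
      Real.exp (-(lam * cumLoss q W i g)) := fun g hg =>
    (((hc g hg).const_mul lam).neg).exp
  have hS : Measurable fun W : Fin n → X × ℝ =>
      ∑ g ∈ G, uniformPrior G g * Real.exp (-(lam * cumLoss q W i g)) :=
    Finset.measurable_sum _ fun g hg => (he g hg).const_mul _
  refine measurable_abs_sub_rpow hq (measurable_pi_apply i).snd ?_
  unfold progressiveMixture mixture gibbs
  exact Finset.measurable_sum _ fun g hg =>
    (((he g hg).div hS).mul_const _).mul ((hG g hg).comp (measurable_pi_apply i).fst)

variable (P : Measure (X × ℝ)) [IsProbabilityMeasure P]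

lemma lintegral_pi_insertNth {n : ℕ} (i : Fin (n + 1)) {f : (Fin (n + 1) → X × ℝ) → ENNReal}
    (hf : Measurable f) :
    ∫⁻ Z : Fin n → X × ℝ, ∫⁻ z, f (i.insertNth z Z) ∂P ∂(Measure.pi fun _ => P) =
      ∫⁻ W, f W ∂(Measure.pi fun _ => P) := by
  have hmp := (measurePreserving_piFinSuccAbove (fun _ : Fin (n + 1) => P) i).symm
  rw [← hmp.lintegral_comp hf]
  exact (lintegral_prod_symm _ (hf.comp hmp.measurable).aemeasurable).symm

/-- The independent test point of the risk becomes entry `i` of a sample of size `n + 1`, on which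
the mixture does not depend. -/
lemma lintegral_risk_progressiveMixture {n : ℕ} {G : Finset (X → ℝ)}
    (hG : ∀ g ∈ G, Measurable g) {q : ℝ} (hq : 0 ≤ q) (lam : ℝ) (i : Fin (n + 1)) :
    ∫⁻ Z : Fin n → X × ℝ, risk P q (progressiveMixture G q lam Z i) ∂(Measure.pi fun _ => P) =
      ∫⁻ W : Fin (n + 1) → X × ℝ, ENNReal.ofReal (loss q (W i) (progressiveMixture G q lam W i))
        ∂(Measure.pi fun _ => P) := by
  rw [← lintegral_pi_insertNth P i
    (measurable_loss_progressiveMixture hG hq lam i).ennreal_ofReal]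
  simp [progressiveMixture_insertNth, risk]

lemma measurable_risk_progressiveMixture {n : ℕ} {G : Finset (X → ℝ)}
    (hG : ∀ g ∈ G, Measurable g) {q : ℝ} (hq : 0 ≤ q) (lam : ℝ) (i : Fin (n + 1)) :
    Measurable fun Z : Fin n → X × ℝ => risk P q (progressiveMixture G q lam Z i) := by
  have hmp := (measurePreserving_piFinSuccAbove (fun _ : Fin (n + 1) => P) i).symm
  have h := ((measurable_loss_progressiveMixture hG hq lam i).ennreal_ofReal.comp
    hmp.measurable).lintegral_prod_left' (μ := P)
  convert h using 2 with Z
  rw [risk]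
  refine lintegral_congr fun z => ?_
  simp [← progressiveMixture_insertNth G q lam Z i z, Fin.insertNthEquiv]

lemma lintegral_eval {n : ℕ} (i : Fin n) {f : X × ℝ → ENNReal} (hf : Measurable f) :
    ∫⁻ W : Fin n → X × ℝ, f (W i) ∂(Measure.pi fun _ => P) = ∫⁻ z, f z ∂P :=
  (measurePreserving_eval (fun _ : Fin n => P) i).lintegral_comp hf

/-- Risk bound for the progressive mixture rule with an arbitrary parameter `lam`. -/
lemma expectedRisk_le {n : ℕ} {G : Finset (X → ℝ)} {q s b κ K M lam : ℝ} (hq : 0 ≤ q)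
    (hs : 0 ≤ s) (hb : 0 ≤ b) (hK0 : 0 ≤ K) (hM : 0 ≤ M)
    (hK : MixingBound.{u} q s b κ K) (hlam : 0 < lam) (hGm : ∀ g ∈ G, Measurable g)
    (hbG : ∀ g ∈ G, ∀ x, |g x| ≤ b)
    (hmom : ∫⁻ z, ENNReal.ofReal ((|z.2| + b) ^ s) ∂P ≤ ENNReal.ofReal M)
    {g : X → ℝ} (hg : g ∈ G) :
    expectedRisk P n G q lam ≤ risk P q g +
      ENNReal.ofReal (K * lam ^ κ * M + Real.log G.card / lam / (n + 1 : ℕ)) := by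
  have hN : ((n + 1 : ℕ) : ENNReal) ≠ 0 := by simp
  have hN' : ((n + 1 : ℕ) : ENNReal) ≠ ⊤ := ENNReal.natCast_ne_top _
  have hlog : 0 ≤ Real.log G.card / lam := div_nonneg (Real.log_natCast_nonneg _) hlam.le
  have hc : 0 ≤ K * lam ^ κ := by positivity
  have hms : Measurable fun z : X × ℝ => ENNReal.ofReal ((|z.2| + b) ^ s) :=
    ((Real.continuous_rpow_const hs).measurable.comp
      ((continuous_abs.measurable.comp measurable_snd).add_const b)).ennreal_ofReal
  have hml : Measurable fun z : X × ℝ => ENNReal.ofReal (loss q z g) :=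
    (measurable_abs_sub_rpow hq measurable_snd ((hGm g hg).comp measurable_fst)).ennreal_ofReal
  have hl0 : ∀ (z : X × ℝ) (f : X → ℝ), 0 ≤ loss q z f := fun z f => by
    unfold loss; positivity
  -- The regret bound is used with `n + 1` rounds, which matches the `n + 1` mixtures being
  -- averaged.
  have hpt : ∀ W : Fin (n + 1) → X × ℝ,
      ∑ i : Fin (n + 1), ENNReal.ofReal (loss q (W i) (progressiveMixture G q lam W i)) ≤
        ∑ i : Fin (n + 1), (ENNReal.ofReal (loss q (W i) g) +
          ENNReal.ofReal (K * lam ^ κ) * ENNReal.ofReal ((|(W i).2| + b) ^ s)) +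
            ENNReal.ofReal (Real.log G.card / lam) := by
    intro W
    rw [← ENNReal.ofReal_sum_of_nonneg fun i _ => hl0 _ _]
    refine (ENNReal.ofReal_le_ofReal (sum_loss_progressiveMixture_le hK hlam hbG W hg)).trans ?_
    have h0 : ∀ i, 0 ≤ K * lam ^ κ * (|(W i).2| + b) ^ s := fun i => by positivity
    rw [ENNReal.ofReal_add (Finset.sum_nonneg fun i _ => add_nonneg (hl0 _ _) (h0 i)) hlog,
      ENNReal.ofReal_sum_of_nonneg fun i _ => add_nonneg (hl0 _ _) (h0 i)]
    refine le_of_eq (congrArg (· + _) (Finset.sum_congr rfl fun i _ => ?_))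
    rw [ENNReal.ofReal_add (hl0 _ _) (h0 i), ENNReal.ofReal_mul hc]
  have hmF : ∀ i : Fin (n + 1), Measurable fun W : Fin (n + 1) → X × ℝ =>
      ENNReal.ofReal (loss q (W i) g) +
        ENNReal.ofReal (K * lam ^ κ) * ENNReal.ofReal ((|(W i).2| + b) ^ s) := fun i =>
    (hml.add (hms.const_mul _)).comp (measurable_pi_apply i)
  have htot : ∫⁻ Z : Fin n → X × ℝ,
      ∑ i : Fin (n + 1), risk P q (progressiveMixture G q lam Z i) ∂(Measure.pi fun _ => P) ≤
        (n + 1 : ℕ) * (risk P q g + ENNReal.ofReal (K * lam ^ κ * M)) +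
          ENNReal.ofReal (Real.log G.card / lam) := by
    rw [lintegral_finsetSum _ fun i _ => measurable_risk_progressiveMixture P hGm hq lam i]
    simp_rw [lintegral_risk_progressiveMixture P hGm hq]
    rw [← lintegral_finsetSum _ fun i _ =>
      (measurable_loss_progressiveMixture hGm hq lam i).ennreal_ofReal]
    refine (lintegral_mono hpt).trans ?_
    rw [lintegral_add_right _ measurable_const, lintegral_const, measure_univ, mul_one,
      lintegral_finsetSum _ fun i _ => hmF i]
    gcongr
    have hi : ∀ i : Fin (n + 1), ∫⁻ W : Fin (n + 1) → X × ℝ, (ENNReal.ofReal (loss q (W i) g) +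
          ENNReal.ofReal (K * lam ^ κ) * ENNReal.ofReal ((|(W i).2| + b) ^ s))
          ∂(Measure.pi fun _ => P) ≤ risk P q g + ENNReal.ofReal (K * lam ^ κ * M) := by
      intro i
      refine (lintegral_eval P i (hml.add (hms.const_mul _))).trans_le ?_
      simp only [Pi.add_apply]
      rw [lintegral_add_left hml,
        lintegral_const_mul _ hms, ENNReal.ofReal_mul hc]
      unfold risk
      gcongr
    refine (Finset.sum_le_sum fun i _ => hi i).trans ?_
    simp [mul_add]
  have hdiv : expectedRisk P n G q lam = (∫⁻ Z : Fin n → X × ℝ,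
      ∑ i : Fin (n + 1), risk P q (progressiveMixture G q lam Z i) ∂(Measure.pi fun _ => P)) /
        (n + 1 : ℕ) := by
    simp only [expectedRisk, div_eq_mul_inv]
    rw [lintegral_mul_const' _ _ (ENNReal.inv_ne_top.2 hN)]
  rw [hdiv, ENNReal.div_le_iff hN hN']
  refine htot.trans (le_of_eq ?_)
  have hn0 : (0 : ℝ) < (n + 1 : ℕ) := by positivity
  rw [ENNReal.ofReal_add (by positivity) (by positivity), ENNReal.ofReal_div_of_pos hn0,
    ENNReal.ofReal_natCast, ← add_assoc, add_mul _ (_ / _), ENNReal.div_mul_cancel hN hN',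
    mul_comm]

lemma expectedRisk_singleton (n : ℕ) (g : X → ℝ) (q lam : ℝ) :
    expectedRisk P n {g} q lam = risk P q g := by
  have h : ∀ (Z : Fin n → X × ℝ) (i : ℕ), progressiveMixture {g} q lam Z i = g := by
    intro Z i
    have := sum_gibbs (Finset.singleton_nonempty g) (fun g => lam * cumLoss q Z i g)
    rw [Finset.sum_singleton] at this
    ext x
    rw [progressiveMixture, mixture, Finset.sum_singleton, this, one_mul]
  simp only [expectedRisk, h, Finset.sum_const, Finset.card_univ, Fintype.card_fin,
    nsmul_eq_mul, lintegral_const, measure_univ, mul_one]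
  rw [mul_comm, ENNReal.mul_div_cancel_right (by simp) (ENNReal.natCast_ne_top _)]

lemma lintegral_abs_add_rpow_le {s b A : ℝ} (hs : 0 ≤ s) (hb : 0 ≤ b) (hA : 0 ≤ A)
    (hmom : ∫⁻ z, ENNReal.ofReal (|z.2| ^ s) ∂P ≤ ENNReal.ofReal A) :
    ∫⁻ z, ENNReal.ofReal ((|z.2| + b) ^ s) ∂P ≤ ENNReal.ofReal (2 ^ s * (A + b ^ s)) := by
  have hpt : ∀ z : X × ℝ, ENNReal.ofReal ((|z.2| + b) ^ s) ≤
      ENNReal.ofReal (2 ^ s) * (ENNReal.ofReal (|z.2| ^ s) + ENNReal.ofReal (b ^ s)) := by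
    intro z
    have h0 := abs_nonneg z.2
    rw [← ENNReal.ofReal_add (by positivity) (by positivity), ← ENNReal.ofReal_mul (by positivity)]
    refine ENNReal.ofReal_le_ofReal ?_
    have h1 : |z.2| + b ≤ 2 * max |z.2| b := by
      linarith [le_max_left |z.2| b, le_max_right |z.2| b]
    have hm : 0 ≤ max |z.2| b := h0.trans (le_max_left _ _)
    refine (Real.rpow_le_rpow (by positivity) h1 hs).trans ?_
    rw [Real.mul_rpow (by norm_num) hm]
    have ha' : 0 ≤ |z.2| ^ s := by positivity
    have hb' : 0 ≤ b ^ s := by positivity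
    have : (max |z.2| b) ^ s ≤ |z.2| ^ s + b ^ s := by
      rcases max_choice |z.2| b with h | h <;> rw [h] <;> linarith
    gcongr
  refine (lintegral_mono hpt).trans ?_
  rw [lintegral_const_mul' _ _ ENNReal.ofReal_ne_top, lintegral_add_right _ measurable_const,
    lintegral_const, measure_univ, mul_one, ENNReal.ofReal_mul (by positivity),
    ENNReal.ofReal_add hA (by positivity)]
  gcongr

/-- Risk bound for the progressive mixture rule with parameter `C₁ (log |G| / n) ^ a`. -/
lemma expectedRisk_le_of_tuned {n : ℕ} {G : Finset (X → ℝ)} (hG : G.Nonempty)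
    {q s b a K M C C₁ : ℝ} (hq : 0 ≤ q) (hs : 0 ≤ s) (hb : 0 ≤ b) (hK0 : 0 ≤ K) (hM : 0 ≤ M)
    (ha : 0 < a) (hC₁ : 0 < C₁) (hn : 1 ≤ n) (hC : K * C₁ ^ (1 / a - 1) * M + 1 / C₁ ≤ C)
    (hK : MixingBound.{u} q s b (1 / a - 1) K) (hGm : ∀ g ∈ G, Measurable g)
    (hbG : ∀ g ∈ G, ∀ x, |g x| ≤ b)
    (hmom : ∫⁻ z, ENNReal.ofReal ((|z.2| + b) ^ s) ∂P ≤ ENNReal.ofReal M) :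
    expectedRisk P n G q (C₁ * (Real.log G.card / n) ^ a) ≤
      G.inf' hG (risk P q) + ENNReal.ofReal (C * (Real.log G.card / n) ^ (1 - a)) := by
  obtain ⟨g, hg, hmin⟩ := G.exists_mem_eq_inf' hG (risk P q)
  rw [hmin]
  -- When `|G| = 1` the logarithm, hence `lam`, is zero and the general bound does not apply; every
  -- mixture is then the sole function.
  rcases (Nat.one_le_iff_ne_zero.2 hG.card_pos.ne').eq_or_lt with h1 | h1
  · obtain ⟨f, rfl⟩ := Finset.card_eq_one.1 h1.symm
    rw [Finset.mem_singleton] at hg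
    rw [expectedRisk_singleton, hg]
    exact le_self_add
  · have hn0 : (0 : ℝ) < n := by exact_mod_cast hn
    have hlog : 0 < Real.log G.card := Real.log_pos (by exact_mod_cast h1)
    have hr : 0 < Real.log G.card / n := div_pos hlog hn0
    refine (expectedRisk_le P hq hs hb hK0 hM hK (by positivity) hGm hbG hmom hg).trans ?_
    gcongr
    set r := Real.log G.card / n with hrdef
    -- Here the exponent `1 / a - 1` pays off: `a * (1 / a - 1) = 1 - a`, the exponent also found in
    -- `e2`.
    have e1 : (C₁ * r ^ a) ^ (1 / a - 1) = C₁ ^ (1 / a - 1) * r ^ (1 - a) := by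
      rw [Real.mul_rpow hC₁.le (by positivity), ← Real.rpow_mul hr.le, mul_sub,
        mul_one_div_cancel ha.ne', mul_one]
    have e2 : Real.log G.card / (C₁ * r ^ a) / (n + 1 : ℕ) ≤ 1 / C₁ * r ^ (1 - a) := by
      calc _ ≤ Real.log G.card / (C₁ * r ^ a) / n := by
            gcongr
            simp
        _ = 1 / C₁ * (r / r ^ a) := by
            rw [hrdef]
            ring
        _ = _ := by rw [Real.rpow_sub hr, Real.rpow_one]
    rw [e1]
    calc _ ≤ (K * C₁ ^ (1 / a - 1) * M + 1 / C₁) * r ^ (1 - a) := by linarith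
      _ ≤ _ := by gcongr

end Probability

end LqReg

/-! ### The two regimes of the final bound -/

theorem corollary7p2 (q s b A C₁ : ℝ) (hq : 1 < q) (hs : q ≤ s) (hb : 0 < b) (hA : 0 < A)
    (hC₁ : 0 < C₁) :
    ∃ C : ℝ, 0 < C ∧
      ∀ (X : Type*) [MeasurableSpace X] (P : Measure (X × ℝ)) [IsProbabilityMeasure P]
        (G : Finset (X → ℝ)) (hG : G.Nonempty) (n : ℕ),
        1 ≤ n →
        (∀ g ∈ G, Measurable g) →
        (∀ g ∈ G, ∀ x, |g x| ≤ b) →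
        ∫⁻ z, ENNReal.ofReal (|z.2| ^ s) ∂P ≤ ENNReal.ofReal A →
        (s ≤ 2 * q - 2 →
          LqReg.expectedRisk P n G q (LqReg.tunedLambda C₁ q s (Real.log G.card / n)) ≤
            G.inf' hG (LqReg.risk P q) +
              ENNReal.ofReal (C * (Real.log G.card / n) ^ (1 - (q - 1) / s))) ∧
        (2 * q - 2 ≤ s →
          LqReg.expectedRisk P n G q (LqReg.tunedLambda C₁ q s (Real.log G.card / n)) ≤
            G.inf' hG (LqReg.risk P q) +
              ENNReal.ofReal (C * (Real.log G.card / n) ^ (1 - q / (s + 2)))) := by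
  have hq0 : 0 < q := by linarith
  have hq1 : 0 < q - 1 := by linarith
  have hs0 : 0 < s := by linarith
  set M : ℝ := 2 ^ s * (A + b ^ s) with hM
  have hM0 : 0 < M := by positivity
  set K₁ : ℝ := (2 * b * q) ^ (s / (q - 1)) with hK₁
  set K₂ : ℝ := (2 * b * q) ^ 2 / 2 * (q / (q - 1)) ^ ((s + 2 - 2 * q) / q) with hK₂
  have hK₁0 : 0 < K₁ := by positivity
  have hK₂0 : 0 < K₂ := by positivity
  set c₁ : ℝ := K₁ * C₁ ^ (1 / ((q - 1) / s) - 1) * M + 1 / C₁ with hc₁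
  set c₂ : ℝ := K₂ * C₁ ^ (1 / (q / (s + 2)) - 1) * M + 1 / C₁ with hc₂
  refine ⟨max c₁ c₂, lt_max_of_lt_left (by positivity), ?_⟩
  intro X _ P _ G hG n hn hGm hbG hmom
  have hmom' := LqReg.lintegral_abs_add_rpow_le P hs0.le hb.le hA.le hmom
  refine ⟨fun h => ?_, fun h => ?_⟩
  · have e : LqReg.tunedLambda C₁ q s (Real.log G.card / n) =
        C₁ * (Real.log G.card / n) ^ ((q - 1) / s) := by
      unfold LqReg.tunedLambda
      split_ifs with h'
      · rfl
      -- At the boundary `tunedLambda` takes its second branch, but both exponents equal `1/2`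
      -- there.
      · have hse : s = 2 * q - 2 := le_antisymm h (not_lt.1 h')
        congr 2
        rw [div_eq_div_iff (by positivity) hs0.ne', hse]
        ring
    rw [e]
    exact LqReg.expectedRisk_le_of_tuned P hG hq0.le hs0.le hb.le hK₁0.le hM0.le (by positivity)
      hC₁ hn (le_max_left c₁ c₂) (LqReg.mixingBound_of_le hq hs h hb) hGm hbG hmom'
  · rw [LqReg.tunedLambda, if_neg (not_lt.2 h)]
    exact LqReg.expectedRisk_le_of_tuned P hG hq0.le hs0.le hb.le hK₂0.le hM0.le (by positivity)
      hC₁ hn (le_max_right c₁ c₂) (LqReg.mixingBound_of_ge hq h hb) hGm hbG hmom'
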